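/- Let $G_0,G_1,G_2,\ldots$ be the Genocchi numbers, defined by $\frac{2x}{e^x+1}=\sum_{m\ge 0}G_m\frac{x^m}{m!}$, and let $H_1,H_3,H_5,\ldots$ be the median Genocchi numbers (Genocchi numbers of the second kind), defined by $$H_{2n-1}=(-1)^n\sum_{j=0}^{\lfloor (n-1)/2\rfloor}\binom{n}{2j+1}G_{2n-2j}\qquad(n\ge 1).$$ Let $h_n=H_{2n+1}/2^n$ be the normalized median Genocchi numbers. For $n\ge 1$ let $$M_{2n}=\left[\left\lfloor\frac{2j-k-1}{2n}\right\rfloor\right]_{1\le j,k\le 2n},$$ and let $\tilde M_{2n}=[m_{i,j}]_{1\le i,j\le 2n}$ be the matrix with $m_{i,j}=1$ if $\lceil i/2\rceil\le j\le n+\lceil i/2\rceil$ and $m_{i,j}=0$ otherwise. Let $\tilde{\mathfrak S}_{2n}$ be the set of permutations $\pi$ of $\{1,\ldots,2n\}$ such that $\pi(i)>\pi(i+1)$ for each $i\in\{1,3,\ldots,2n-1\}$ and $\lceil i/2\rceil\le\pi(i)\le n+\lceil i/2\rceil$ for all $i$. A Dellac configuration of size $n$ is a set of $2n$ dots in the cells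 $(x,y)$, $1\le x\le n$, $1\le y\le 2n$, of a tableau with $n$ columns $x$ and $2n$ rows $y$, such that $x\le y\le n+x$ for each dot $(x,y)$, each row contains exactly one dot and each column contains exactly two dots; let $DC_n$ be the set of these. Then for every integer $n\ge 1$: 1. $\mathrm{per}(M_{2n})=(-1)^nH_{2n-1}$. 2. $\mathrm{per}(\tilde M_{2n})=H_{2n+1}=2^nh_n$ and $\mathrm{per}(\tilde M_{2n})=2^n\,|\tilde{\mathfrak S}_{2n}|$. 3. $|\tilde{\mathfrak S}_{2n}|=|DC_n|=h_n$, and sending a Dellac configuration to the list of the $y$-coordinates of its dots, read from the leftmost column to the rightmost and in decreasing order inside each column, defines a bijection from $DC_n$ onto $\tilde{\mathfrak S}_{2n}$ (permutations written in one-line notation). -/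

import Mathlib

/-- The Genocchi number `G_n` (of the first kind), rational by definition:
`2x / (e^x + 1) = ∑ G_n x^n / n!` as formal power series over `ℚ`. -/
noncomputable def genocchi (n : ℕ) : ℚ :=
  (n.factorial : ℚ) *
    PowerSeries.coeff n (2 * PowerSeries.X * (PowerSeries.exp ℚ + 1)⁻¹ : PowerSeries ℚ)

/-- `medianGenocchi n` is the median Genocchi number (Genocchi number of the second kind)
of index `2n - 1`, usually written `H_{2n-1}`, for `n ≥ 1`:
`H_{2n-1} = (-1)^n ∑_{j=0}^{⌊(n-1)/2⌋} (n choose 2j+1) G_{2n-2j}`. -/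
noncomputable def medianGenocchi (n : ℕ) : ℚ :=
  (-1) ^ n * ∑ j ∈ Finset.range ((n - 1) / 2 + 1),
    (n.choose (2 * j + 1) : ℚ) * genocchi (2 * n - 2 * j)

/-- The normalized median Genocchi number `h_n = H_{2n+1} / 2^n`. -/
noncomputable def normalizedMedianGenocchi (n : ℕ) : ℚ :=
  medianGenocchi (n + 1) / 2 ^ n

/-- The matrix `M_{2n} = [⌊(2j - k - 1) / (2n)⌋]`, `1 ≤ j, k ≤ 2n`. The indices of type
`Fin (2 * n)` start at `0`, hence the shifts by one. -/
def luschnyMatrix (n : ℕ) : Matrix (Fin (2 * n)) (Fin (2 * n)) ℤ :=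
  Matrix.of fun j k =>
    ⌊(2 * ((j.val : ℚ) + 1) - ((k.val : ℚ) + 1) - 1) / (2 * (n : ℚ))⌋

/-- The band condition `⌈a/2⌉ ≤ b ≤ n + ⌈a/2⌉` for `1 ≤ a, b ≤ 2n`, with `a = i + 1` and
`b = j + 1`, so that `⌈a/2⌉ = ⌊i/2⌋ + 1`. -/
def InBand (n : ℕ) (i j : Fin (2 * n)) : Prop :=
  i.val / 2 + 1 ≤ j.val + 1 ∧ j.val + 1 ≤ n + (i.val / 2 + 1)

instance (n : ℕ) (i j : Fin (2 * n)) : Decidable (InBand n i j) :=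
  inferInstanceAs (Decidable (_ ∧ _))

/-- The `0`-`1` matrix of size `2n` whose `(i, j)` entry, `1 ≤ i, j ≤ 2n`, is `1` if
`⌈i/2⌉ ≤ j ≤ n + ⌈i/2⌉`, and `0` otherwise. -/
def bandMatrix (n : ℕ) : Matrix (Fin (2 * n)) (Fin (2 * n)) ℤ :=
  Matrix.of fun i j => if InBand n i j then 1 else 0

/-- The set of permutations `π` of `{1, …, 2n}` which have a descent at each of the positions
`1, 3, …, 2n - 1` and satisfy `⌈i/2⌉ ≤ π(i) ≤ n + ⌈i/2⌉` for all `i`. -/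
def bandPerms (n : ℕ) : Set (Equiv.Perm (Fin (2 * n))) :=
  {π | (∀ (t : ℕ) (ht : t < n), π ⟨2 * t + 1, by omega⟩ < π ⟨2 * t, by omega⟩) ∧
    ∀ i, InBand n i (π i)}

/-- The one-line notation `π(1) π(2) ⋯ π(m)` of a permutation. -/
def oneLine {m : ℕ} (π : Equiv.Perm (Fin m)) : List (Fin m) := List.ofFn π

/-- The set of rows that contain a dot in column `c`, where `(x, y) ∈ C` says that there is a dot
in column `x` (counted from the left) and row `y` (counted from the bottom). -/
def columnRows {n : ℕ} (C : Finset (Fin n × Fin (2 * n))) (c : Fin n) : Finset (Fin (2 * n)) :=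
  Finset.univ.filter fun r => (c, r) ∈ C

/-- Dellac configurations of size `n`: sets of `2n` dots in a tableau of width `n` and
height `2n`, such that the dots lie between the lines `y = x` and `y = n + x`
(in cells `(x, y)` with `x ≤ y ≤ n + x`), each row contains exactly one dot and each column
contains exactly two. -/
def dellacConfigs (n : ℕ) : Set (Finset (Fin n × Fin (2 * n))) :=
  {C | C.card = 2 * n ∧
    (∀ p ∈ C, p.1.val + 1 ≤ p.2.val + 1 ∧ p.2.val + 1 ≤ n + (p.1.val + 1)) ∧
    (∀ r, ∃! c, (c, r) ∈ C) ∧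
    ∀ c, (columnRows C c).card = 2}

/-- The list of the `y`-coordinates of the dots, read from the leftmost column to the rightmost
one, and from the top down (in decreasing order) inside each column. -/
def readingWord {n : ℕ} (C : Finset (Fin n × Fin (2 * n))) : List (Fin (2 * n)) :=
  (List.finRange n).flatMap fun c => (columnRows C c).sort (fun a b => b ≤ a)

/-! Everything is compared with one array, `pathCount`: weighted Motzkin paths whose step weights
are built from `d ^ 2` and `(d + 1) ^ 2`.

On the arithmetic side, `pathCount m 0` is the m-th moment of a functional taking the value 1 on
every product `∏ (X + i(i+1)) / (i+1)^2` (`pathFunctional_legendreBasis`). The functional `X^k ↦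
G_{k+1}`, composed with the substitution `X ↦ -X(X+1)`, takes the same values
(`genocchiFunctional_shiftedLegendreBasis`), so the two agree. Expanding `(-X(X+1))^m` and dropping
the vanishing odd-index Genocchi numbers leaves the median Genocchi number
(`pathCount_eq_medianGenocchi`).

On the combinatorial side, both permanents count, up to sign, permutations in which the values of
one half are bounded above and those of the other half below, by bounds that are monotone in the
position. Filling positions from left to right gives a recursion (`card_twoSidedMaps`), in which two
consecutive positions act as one path step.

Finally, exchanging the entries of a position pair is a free action preserving the band, which
accounts for `2 ^ n`; the descending representatives are the column readings of Dellac
configurations. -/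

section Genocchi

open Polynomial

/-! ### Weighted paths and their moment functionals. -/

/-- The weighted count of lattice paths of `m` steps ending at height `d`, where the steps from
height `d` to `d - 1`, `d`, `d + 1` have weights `d²`, `d² + (d + 1)²`, `(d + 1)²`. -/
def pathCount : ℕ → ℕ → ℕ
  | 0, d => if d = 0 then 1 else 0
  | m + 1, d => (d + 1) ^ 2 * pathCount m (d + 1) + (d ^ 2 + (d + 1) ^ 2) * pathCount m d +
      d ^ 2 * pathCount m (d - 1)

/-- The linear functional with `X ^ m ↦ pathCount m d`. -/
noncomputable def pathFunctional (d : ℕ) : ℚ[X] →ₗ[ℚ] ℚ :=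
  (Polynomial.basisMonomials ℚ).constr ℚ fun m => (pathCount m d : ℚ)

theorem basisMonomials_constr_X_pow (f : ℕ → ℚ) (m : ℕ) :
    (Polynomial.basisMonomials ℚ).constr ℚ f (X ^ m) = f m := by
  have h := (Polynomial.basisMonomials ℚ).constr_basis ℚ f m
  rw [Polynomial.X_pow_eq_monomial]
  simpa only [Polynomial.coe_basisMonomials] using h

theorem linearMap_ext_X_pow {f g : ℚ[X] →ₗ[ℚ] ℚ} (h : ∀ m : ℕ, f (X ^ m) = g (X ^ m)) :
    f = g := by
  refine (Polynomial.basisMonomials ℚ).ext fun m => ?_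
  simpa [Polynomial.coe_basisMonomials, Polynomial.monomial_one_right_eq_X_pow] using h m

theorem pathFunctional_X_pow (d m : ℕ) : pathFunctional d (X ^ m) = pathCount m d :=
  basisMonomials_constr_X_pow _ m

theorem pathFunctional_X_mul (d : ℕ) (p : ℚ[X]) :
    pathFunctional d (X * p) = ((d : ℚ) + 1) ^ 2 * pathFunctional (d + 1) p +
      ((d : ℚ) ^ 2 + ((d : ℚ) + 1) ^ 2) * pathFunctional d p +
      (d : ℚ) ^ 2 * pathFunctional (d - 1) p := by
  have h : pathFunctional d ∘ₗ LinearMap.mulLeft ℚ X =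
      ((d : ℚ) + 1) ^ 2 • pathFunctional (d + 1) +
      ((d : ℚ) ^ 2 + ((d : ℚ) + 1) ^ 2) • pathFunctional d +
      (d : ℚ) ^ 2 • pathFunctional (d - 1) := by
    refine linearMap_ext_X_pow fun m => ?_
    simp only [LinearMap.comp_apply, LinearMap.mulLeft_apply, ← pow_succ', LinearMap.add_apply,
      LinearMap.smul_apply, pathFunctional_X_pow, smul_eq_mul, pathCount]
    push_cast
    ring
  simpa using LinearMap.congr_fun h p

/-- The polynomials `∏_{i < k} (X + i (i + 1)) / (i + 1) ^ 2`. -/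
noncomputable def legendreBasis : ℕ → ℚ[X]
  | 0 => 1
  | k + 1 => C (1 / ((k : ℚ) + 1) ^ 2) * ((X + C ((k : ℚ) * (k + 1))) * legendreBasis k)

theorem X_mul_legendreBasis (k : ℕ) :
    X * legendreBasis k = C (((k : ℚ) + 1) ^ 2) * legendreBasis (k + 1) -
      C ((k : ℚ) * (k + 1)) * legendreBasis k := by
  have hk : ((k : ℚ) + 1) ^ 2 * (1 / ((k : ℚ) + 1) ^ 2) = 1 := by
    have : (k : ℚ) + 1 ≠ 0 := by positivity
    field_simp
  rw [legendreBasis, ← mul_assoc, ← C_mul, hk]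
  simp only [C_1]
  ring

theorem succ_mul_cast_choose_succ (k d : ℕ) :
    ((d : ℚ) + 1) * k.choose (d + 1) = (k - d) * k.choose d := by
  rcases le_or_gt d k with h | h
  · have := Nat.choose_succ_right_eq k d
    rw [← Nat.cast_sub h]
    exact_mod_cast (by linarith : (d + 1) * k.choose (d + 1) = (k - d) * k.choose d)
  · rw [Nat.choose_eq_zero_of_lt h, Nat.choose_eq_zero_of_lt (by omega)]
    simp

/-- Multiplication by `X + k(k+1)` turns the path recursion into an identity between neighbouring
binomial coefficients, by `(d+1) C(k,d+1) = (k-d) C(k,d)`. The case `d = 0` matters most: the value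
is 1 for all `k`. -/
theorem pathFunctional_legendreBasis (k d : ℕ) :
    pathFunctional d (legendreBasis k) = k.choose d := by
  induction k generalizing d with
  | zero =>
    have := pathFunctional_X_pow d 0
    rw [pow_zero] at this
    rw [legendreBasis, this, pathCount]
    rcases d with _ | d <;> simp
  | succ k ih =>
    have hk : ((k : ℚ) + 1) ≠ 0 := by positivity
    rw [legendreBasis, add_mul, ← smul_eq_C_mul, ← smul_eq_C_mul, map_smul, map_add, map_smul,
      pathFunctional_X_mul]
    simp only [ih, smul_eq_mul]
    rcases d with _ | d
    · have h1 := succ_mul_cast_choose_succ k 0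
      push_cast at h1 ⊢
      simp only [Nat.choose_zero_right, Nat.cast_one] at h1 ⊢
      field_simp
      linear_combination h1
    · have h1 := succ_mul_cast_choose_succ k (d + 1)
      have h2 := succ_mul_cast_choose_succ k d
      rw [Nat.choose_succ_succ]
      push_cast at h1 ⊢
      field_simp
      linear_combination ((d : ℚ) + 2) * h1 + (k + d + 2 : ℚ) * h2

/-! ### Genocchi numbers as moments, with their shift and reflection rules. -/

/-- The linear functional with `X ^ k ↦ G_{k+1} / (k + 1)`. -/
noncomputable def eulerFunctional : ℚ[X] →ₗ[ℚ] ℚ :=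
  (Polynomial.basisMonomials ℚ).constr ℚ fun k => genocchi (k + 1) / (k + 1)

theorem eulerFunctional_X_pow (k : ℕ) :
    eulerFunctional (X ^ k) = genocchi (k + 1) / (k + 1) :=
  basisMonomials_constr_X_pow _ k

theorem genocchi_zero : genocchi 0 = 0 := by
  simp [genocchi, mul_assoc]

theorem sum_choose_mul_genocchi (n : ℕ) :
    ∑ j ∈ Finset.range (n + 1), (n.choose j : ℚ) * genocchi j + genocchi n =
      if n = 1 then 2 else 0 := by
  have hc : PowerSeries.constantCoeff (PowerSeries.exp ℚ + 1) ≠ 0 := by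
    simp
  have h : (2 * PowerSeries.X * (PowerSeries.exp ℚ + 1)⁻¹ : PowerSeries ℚ) * PowerSeries.exp ℚ +
      2 * PowerSeries.X * (PowerSeries.exp ℚ + 1)⁻¹ = 2 * PowerSeries.X := by
    rw [← mul_add_one, mul_assoc, PowerSeries.inv_mul_cancel _ hc, mul_one]
  have h2 := congrArg (fun f => (n.factorial : ℚ) * PowerSeries.coeff n f) h
  simp only [map_add, mul_add] at h2
  have h3 : (n.factorial : ℚ) * PowerSeries.coeff n (2 * PowerSeries.X : PowerSeries ℚ) =
      if n = 1 then 2 else 0 := by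
    rw [show (2 : PowerSeries ℚ) = PowerSeries.C (2 : ℚ) from (map_ofNat _ 2).symm,
      PowerSeries.coeff_C_mul, PowerSeries.coeff_X]
    split_ifs with h <;> simp [h]
  rw [← h3, ← h2, PowerSeries.coeff_mul, Finset.Nat.sum_antidiagonal_eq_sum_range_succ_mk,
    Finset.mul_sum]
  congr 1
  refine Finset.sum_congr rfl fun j hj => ?_
  have hj : j ≤ n := by simpa [Nat.lt_succ_iff] using hj
  rw [genocchi, PowerSeries.coeff_exp, Nat.cast_choose ℚ hj]
  have := Nat.factorial_ne_zero j
  have := Nat.factorial_ne_zero (n - j)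
  simp
  field_simp

/-- This is `(e^x + 1) · 2x/(e^x + 1) = 2x` read coefficientwise on monomials. -/
theorem eulerFunctional_add_comp (f : ℚ[X]) :
    eulerFunctional f + eulerFunctional (f.comp (X + 1)) = 2 * f.eval 0 := by
  have h : eulerFunctional + eulerFunctional ∘ₗ (compRingHom (X + 1 : ℚ[X])).toAddMonoidHom.toRatLinearMap =
      (2 : ℚ) • (leval 0 : ℚ[X] →ₗ[ℚ] ℚ) := by
    refine linearMap_ext_X_pow fun k => ?_
    have h1 := sum_choose_mul_genocchi (k + 1)
    rw [Finset.sum_range_succ', genocchi_zero, mul_zero, add_zero] at h1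
    have hk : ((k : ℚ) + 1) ≠ 0 := by positivity
    have h2 : eulerFunctional ((X + 1) ^ k) * (k + 1) =
        ∑ j ∈ Finset.range (k + 1), ((k + 1).choose (j + 1) : ℚ) * genocchi (j + 1) := by
      rw [add_pow, map_sum, Finset.sum_mul]
      refine Finset.sum_congr rfl fun j _ => ?_
      have h3 : ((k : ℚ) + 1) * k.choose j = (k + 1).choose (j + 1) * (j + 1) := by
        exact_mod_cast Nat.add_one_mul_choose_eq k j
      have hj : ((j : ℚ) + 1) ≠ 0 := by positivity
      rw [one_pow, mul_one, mul_comm (X ^ j), ← C_eq_natCast, ← smul_eq_C_mul, map_smul,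
        eulerFunctional_X_pow, smul_eq_mul]
      field_simp
      linear_combination genocchi (j + 1) * h3
    rw [← h2] at h1
    simp [eulerFunctional_X_pow]
    field_simp
    rw [add_comm, mul_comm, h1]
    rcases k with _ | k <;> simp
  simpa using LinearMap.congr_fun h f

theorem eulerFunctional_comp_neg (f : ℚ[X]) :
    eulerFunctional (f.comp (-1 - X)) = eulerFunctional f := by
  have h : ∀ k : ℕ, eulerFunctional ((X ^ k : ℚ[X]).comp (-1 - X)) = eulerFunctional (X ^ k) := by
    intro k
    induction k using Nat.strong_induction_on with
    | _ k ih =>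
      have h1 := eulerFunctional_add_comp (X ^ k)
      have h2 := eulerFunctional_add_comp ((X ^ k : ℚ[X]).comp (- X))
      rw [comp_assoc] at h2
      have h3 : (X ^ k : ℚ[X]).comp (-X) = ((X + 1) ^ k : ℚ[X]).comp (-1 - X) := by
        simp only [pow_comp, add_comp, X_comp, one_comp]
        congr 1
        ring
      have h4 : (-X : ℚ[X]).comp (X + 1) = -1 - X := by simp; ring
      rw [h4, h3, eval_comp] at h2
      -- The difference has degree below `k`, so induction applies to it. The shift rules `h1` and
      -- `h2` give the corresponding equality for the sum of `X ^ k` and `(X + 1) ^ k`; sum and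
      -- difference together determine `X ^ k`.
      have h5 : eulerFunctional (((X + 1) ^ k - X ^ k : ℚ[X]).comp (-1 - X)) =
          eulerFunctional ((X + 1) ^ k - X ^ k : ℚ[X]) := by
        rw [add_pow, Finset.sum_range_succ]
        simp only [one_pow, mul_one, Nat.choose_self, Nat.cast_one, add_sub_cancel_right]
        rw [Polynomial.sum_comp, map_sum, map_sum]
        refine Finset.sum_congr rfl fun j hj => ?_
        rw [mul_comm, ← C_eq_natCast, ← smul_eq_C_mul, smul_comp, map_smul, map_smul,
          ih j (by simpa using hj)]
      simp only [sub_comp, map_sub] at h5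
      simp at h1 h2 h5 ⊢
      linarith
  induction f using Polynomial.induction_on' with
  | add p q hp hq => simp [hp, hq]
  | monomial n a =>
    rw [← C_mul_X_pow_eq_monomial, mul_comp, C_comp, ← smul_eq_C_mul, ← smul_eq_C_mul, map_smul,
      map_smul, h]

/-- For even `k`, reflection and shift send `X ^ k` to the same polynomial, so the shift rule says
that twice its value is 0. -/
theorem genocchi_odd {k : ℕ} (hk : Even k) (h0 : k ≠ 0) : genocchi (k + 1) = 0 := by
  have h1 := eulerFunctional_add_comp (X ^ k)
  have h2 := eulerFunctional_comp_neg (X ^ k)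
  have h3 : (X ^ k : ℚ[X]).comp (-1 - X) = (X ^ k : ℚ[X]).comp (X + 1) := by
    simp only [X_pow_comp]
    rw [← hk.neg_pow]
    congr 1
    ring
  rw [← h3, h2, eulerFunctional_X_pow] at h1
  have hk : ((k : ℚ) + 1) ≠ 0 := by positivity
  simp [h0] at h1
  rcases h1 with h | h
  · exact h
  · exact absurd h hk

/-- The linear functional with `X ^ k ↦ G_{k+1}`. -/
noncomputable def genocchiFunctional : ℚ[X] →ₗ[ℚ] ℚ :=
  eulerFunctional ∘ₗ derivative ∘ₗ LinearMap.mulLeft ℚ X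

theorem genocchiFunctional_apply (f : ℚ[X]) :
    genocchiFunctional f = eulerFunctional (derivative (X * f)) := rfl

theorem genocchiFunctional_X_pow (k : ℕ) : genocchiFunctional (X ^ k) = genocchi (k + 1) := by
  have hk : ((k : ℚ) + 1) ≠ 0 := by positivity
  rw [genocchiFunctional_apply, ← pow_succ', derivative_X_pow, ← smul_eq_C_mul, map_smul,
    Nat.add_sub_cancel, eulerFunctional_X_pow]
  push_cast
  rw [smul_eq_mul]
  field_simp

/-! ### The Genocchi functional on the substituted basis. -/

/-- The polynomials `∏_{i < k} (i (i + 1) - X (X + 1)) / (i + 1) ^ 2`. -/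
noncomputable def shiftedLegendreBasis (k : ℕ) : ℚ[X] := (legendreBasis k).comp (-(X * (X + 1)))

theorem shiftedLegendreBasis_zero : shiftedLegendreBasis 0 = 1 := by
  simp [shiftedLegendreBasis, legendreBasis]

theorem shiftedLegendreBasis_succ (k : ℕ) :
    shiftedLegendreBasis (k + 1) = C (1 / ((k : ℚ) + 1) ^ 2) *
      ((C (k : ℚ) * (C (k : ℚ) + 1) - X * (X + 1)) * shiftedLegendreBasis k) := by
  simp only [shiftedLegendreBasis, legendreBasis, mul_comp, C_comp, add_comp, X_comp, C_mul, C_add,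
    C_1, one_comp]
  ring

theorem shiftedLegendreBasis_comp_neg (k : ℕ) :
    (shiftedLegendreBasis k).comp (-1 - X) = shiftedLegendreBasis k := by
  rw [shiftedLegendreBasis, comp_assoc]
  congr 1
  simp
  ring

/-- Each factor splits as `i(i+1) - X(X+1) = (i - X)(i + 1 + X)`, so the shifted product telescopes
against the original. -/
theorem shiftedLegendreBasis_comp_add_one (k : ℕ) :
    (shiftedLegendreBasis k).comp (X + 1) * (X + 1 - C (k : ℚ)) =
      shiftedLegendreBasis k * (X + 1 + C (k : ℚ)) := by
  induction k with
  | zero => simp [shiftedLegendreBasis_zero]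
  | succ k ih =>
    rw [shiftedLegendreBasis_succ]
    simp only [mul_comp, C_comp, add_comp, X_comp, sub_comp, one_comp]
    push_cast
    simp only [C_add, C_1]
    linear_combination (-C (1 / ((k : ℚ) + 1) ^ 2) * (X - C (k : ℚ)) * (X + C (k : ℚ) + 2)) * ih

theorem natCast_mul_eval_shiftedLegendreBasis (k : ℕ) :
    (k : ℚ) * (shiftedLegendreBasis k).eval 0 = 0 := by
  induction k with
  | zero => simp
  | succ k ih =>
    rw [shiftedLegendreBasis_succ]
    simp
    rcases mul_eq_zero.1 ih with h | h
    · exact Or.inr (Or.inl (Or.inl (by exact_mod_cast h)))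
    · exact Or.inr (Or.inr h)

/-- The derivative of a polynomial symmetric under `X ↦ -1 - X` is antisymmetric, and the functional
is symmetric. -/
theorem eulerFunctional_derivative_shiftedLegendreBasis (k : ℕ) :
    eulerFunctional (derivative (shiftedLegendreBasis k)) = 0 := by
  have h := congrArg derivative (shiftedLegendreBasis_comp_neg k)
  rw [derivative_comp] at h
  have h2 := congrArg eulerFunctional h
  simp only [derivative_sub, derivative_neg, derivative_one, derivative_X] at h2
  simp only [neg_zero, zero_sub, neg_mul, one_mul, map_neg] at h2
  rw [eulerFunctional_comp_neg] at h2
  linarith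

theorem genocchiFunctional_shiftedLegendreBasis (k : ℕ) :
    genocchiFunctional (shiftedLegendreBasis k) = 1 := by
  induction k with
  | zero =>
    have h := sum_choose_mul_genocchi 1
    have h1 := genocchiFunctional_X_pow 0
    rw [pow_zero] at h1
    simp [Finset.sum_range_succ, genocchi_zero] at h
    rw [shiftedLegendreBasis_zero, h1]
    simp
    linarith
  | succ k ih =>
    rw [← ih]
    have hk : ((k : ℚ) + 1) ≠ 0 := by positivity
    set a : ℚ := -1 / (2 * ((k : ℚ) + 1) ^ 2) with ha
    set q := shiftedLegendreBasis k with hq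
    -- `R` is chosen so that `X (P_{k+1} - P_k) = R + R(X+1) - c P_k` for the basis polynomials `P`
    -- and a constant `c`. After differentiation the `R` terms contribute `2 R'(0)`, a multiple of
    -- `k * q(0) = 0`, and the last term vanishes by symmetry.
    set R : ℚ[X] := C a * (X ^ 2 - C (1 / 2) * X) * ((X - C (k : ℚ)) * q) with hR
    have hC : (C (1 / ((k : ℚ) + 1) ^ 2) : ℚ[X]) = -2 * C a := by
      rw [show (-2 : ℚ[X]) = C (-2) by rw [C_neg]; rfl, ← C_mul]
      congr 1
      rw [ha]
      field_simp
    have hC1 : (C (1 / ((k : ℚ) + 1) ^ 2) : ℚ[X]) * (C (k : ℚ) + 1) ^ 2 = 1 := by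
      rw [← C_1, ← C_add, ← C_pow, ← C_mul]
      congr 1
      field_simp
    have hhalf : (2 : ℚ[X]) * C (1 / 2) = 1 := by
      rw [show (2 : ℚ[X]) = C 2 from rfl, ← C_mul]
      norm_num
    have key : X * shiftedLegendreBasis (k + 1) = X * q + (R + R.comp (X + 1)) -
        C (a * (k + 1) / 2) * q := by
      have h := shiftedLegendreBasis_comp_add_one k
      have hC2 : (C (a * (k + 1) / 2) : ℚ[X]) = C a * (C (k : ℚ) + 1) * C (1 / 2) := by
        rw [← C_1, ← C_add, ← C_mul, ← C_mul]
        congr 1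
        ring
      rw [shiftedLegendreBasis_succ, hR, hC2]
      simp only [mul_comp, C_comp, sub_comp, X_comp, X_pow_comp]
      rw [hC] at hC1 ⊢
      linear_combination (-C a * ((X + 1) ^ 2 - C (1 / 2) * (X + 1))) * h + X * q * hC1 +
        C a * q * (X ^ 2 + X + C (k : ℚ) + 1) * hhalf
    have hd : eulerFunctional (derivative R) + eulerFunctional (derivative (R.comp (X + 1))) = 0 := by
      have h := eulerFunctional_add_comp (derivative R)
      have h2 : derivative (R.comp (X + 1)) = (derivative R).comp (X + 1) := by
        simp [derivative_comp]
      rw [h2, h, hR]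
      have := natCast_mul_eval_shiftedLegendreBasis k
      rw [← hq] at this
      have hk0 : (k : ℚ) = 0 ∨ q.eval 0 = 0 := mul_eq_zero.1 this
      rcases hk0 with h | h <;> simp [h]
    rw [genocchiFunctional_apply, genocchiFunctional_apply, key]
    simp only [map_add, map_sub, ← smul_eq_C_mul, map_smul]
    rw [eulerFunctional_derivative_shiftedLegendreBasis, hd]
    simp

theorem genocchiFunctional_comp (p : ℚ[X]) :
    genocchiFunctional (p.comp (-(X * (X + 1)))) = pathFunctional 0 p := by
  -- Keeping `k` free lets a factor `X` be absorbed into basis elements `k` and `k + 1`; then `k =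
  -- 0` covers all monomials without a spanning argument.
  have h : ∀ m k : ℕ, genocchiFunctional ((X ^ m * legendreBasis k).comp (-(X * (X + 1)))) =
      pathFunctional 0 (X ^ m * legendreBasis k) := by
    intro m
    induction m with
    | zero =>
      intro k
      rw [pow_zero, one_mul, pathFunctional_legendreBasis, Nat.choose_zero_right, Nat.cast_one]
      exact genocchiFunctional_shiftedLegendreBasis k
    | succ m ih =>
      intro k
      rw [pow_succ, mul_assoc, X_mul_legendreBasis, mul_sub, mul_left_comm, mul_left_comm (X ^ m),
        sub_comp, ← smul_eq_C_mul, ← smul_eq_C_mul, smul_comp, smul_comp]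
      simp only [map_sub, map_smul, ih]
  induction p using Polynomial.induction_on' with
  | add p q hp hq => rw [add_comp, map_add, map_add, hp, hq]
  | monomial n a =>
    have := h n 0
    rw [legendreBasis, mul_one] at this
    rw [← C_mul_X_pow_eq_monomial, ← smul_eq_C_mul, smul_comp, map_smul, map_smul, this]

theorem pathCount_eq_medianGenocchi {m : ℕ} (hm : 1 ≤ m) :
    (pathCount m 0 : ℚ) = medianGenocchi m := by
  rw [← pathFunctional_X_pow, ← genocchiFunctional_comp, X_pow_comp, neg_pow, mul_pow, add_comm X,
    add_pow, Finset.mul_sum, Finset.mul_sum, map_sum, medianGenocchi, Finset.mul_sum]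
  have h : ∀ i ∈ Finset.range (m + 1), genocchiFunctional ((-1) ^ m *
      (X ^ m * (1 ^ i * X ^ (m - i) * (m.choose i : ℚ[X])))) =
      (-1) ^ m * ((m.choose i : ℚ) * genocchi (2 * m - i + 1)) := by
    intro i hi
    have hi : i ≤ m := by simpa [Nat.lt_succ_iff] using hi
    have : (-1) ^ m * (X ^ m * (1 ^ i * X ^ (m - i) * (m.choose i : ℚ[X]))) =
        C ((-1) ^ m * (m.choose i : ℚ)) * X ^ (2 * m - i) := by
      rw [show 2 * m - i = m + (m - i) by omega, pow_add]
      simp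
      ring
    rw [this, ← smul_eq_C_mul, map_smul, genocchiFunctional_X_pow, smul_eq_mul, mul_assoc]
  rw [Finset.sum_congr rfl h]
  symm
  -- Only odd `i` survive: for even `i` the index `2m - i + 1` is odd and exceeds 1, because `i ≤ m`
  -- and `1 ≤ m`.
  refine Finset.sum_of_injOn (fun j => 2 * j + 1) (fun a _ b _ h => by simpa using h) ?_ ?_ ?_
  · intro j hj
    simp at hj ⊢
    omega
  · intro i hi hi2
    rw [genocchi_odd, mul_zero, mul_zero]
    · by_contra hodd
      refine hi2 ⟨(i - 1) / 2, ?_, ?_⟩ <;> simp [Nat.even_iff] at hi hodd ⊢ <;> omega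
    · simp at hi
      by_contra h0
      omega
  · intro j hj
    simp at hj
    congr 3
    omega

end Genocchi

/-! ### Counting permutations with two-sided monotone restrictions. -/

section TwoSided

/-- The allowed values at position `i`: left values below `α i`, right values from `β i` on. -/
def TwoSidedAllowed {n : ℕ} (α β : ℕ → ℕ) (i : ℕ) : Fin n ⊕ Fin n → Prop :=
  Sum.elim (fun s => s.val < α i) (fun s => β i ≤ s.val)

open Classical in
/-- The injective maps with allowed values whose set of right values is `B`. -/
noncomputable def twoSidedMaps {n : ℕ} (α β : ℕ → ℕ) (k : ℕ) (B : Finset (Fin n)) :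
    Finset (Fin k → Fin n ⊕ Fin n) :=
  Finset.univ.filter fun τ => Function.Injective τ ∧
    (∀ i : Fin k, TwoSidedAllowed α β i (τ i)) ∧ ∀ s, s ∈ B ↔ ∃ i, τ i = Sum.inr s

theorem mem_twoSidedMaps {n : ℕ} {α β : ℕ → ℕ} {k : ℕ} {B : Finset (Fin n)}
    {τ : Fin k → Fin n ⊕ Fin n} : τ ∈ twoSidedMaps α β k B ↔ Function.Injective τ ∧
      (∀ i : Fin k, TwoSidedAllowed α β i (τ i)) ∧ ∀ s, s ∈ B ↔ ∃ i, τ i = Sum.inr s := by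
  simp [twoSidedMaps]

/-- The number of maps in `twoSidedMaps α β k B` if `B` has `b` elements. -/
def twoSidedCount (α β : ℕ → ℕ) : ℕ → ℕ → ℕ
  | 0, b => if b = 0 then 1 else 0
  | k + 1, b => (b - β k) * twoSidedCount α β k (b - 1) +
      (α k - (k - b)) * twoSidedCount α β k b

theorem card_filter_pi_snoc {X : Type*} [Fintype X] {k : ℕ} (p : (Fin (k + 1) → X) → Prop)
    [DecidablePred p] :
    (Finset.univ.filter p).card =
      ∑ x : X, (Finset.univ.filter fun τ : Fin k → X => p (Fin.snoc (α := fun _ => X) τ x)).card := by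
  simp only [Finset.card_filter]
  rw [← Fintype.sum_prod_type' (f := fun x τ => if p (Fin.snoc (α := fun _ => X) τ x) then 1 else 0)]
  exact (Fintype.sum_equiv (Fin.snocEquiv fun _ => X) _ _ fun x => rfl).symm

/-- Prescribing `B.erase s` as the earlier right values already makes `s` unused, so no separate
freshness condition appears. -/
theorem snoc_inr_mem_twoSidedMaps {n : ℕ} {α β : ℕ → ℕ} {k : ℕ} {B : Finset (Fin n)}
    {τ : Fin k → Fin n ⊕ Fin n} {s : Fin n} :
    Fin.snoc (α := fun _ => Fin n ⊕ Fin n) τ (Sum.inr s) ∈ twoSidedMaps α β (k + 1) B ↔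
      (s ∈ B ∧ β k ≤ s.val) ∧ τ ∈ twoSidedMaps α β k (B.erase s) := by
  simp only [mem_twoSidedMaps, Fin.snoc_injective_iff,
    Fin.forall_fin_succ', Fin.exists_fin_succ', Fin.snoc_castSucc, Fin.snoc_last, Set.mem_range,
    Fin.val_castSucc, Fin.val_last, TwoSidedAllowed, Sum.elim_inr, Finset.mem_erase, Sum.inr.injEq]
  grind

theorem snoc_inl_mem_twoSidedMaps {n : ℕ} {α β : ℕ → ℕ} {k : ℕ} {B : Finset (Fin n)}
    {τ : Fin k → Fin n ⊕ Fin n} {s : Fin n} :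
    Fin.snoc (α := fun _ => Fin n ⊕ Fin n) τ (Sum.inl s) ∈ twoSidedMaps α β (k + 1) B ↔
      τ ∈ twoSidedMaps α β k B ∧ s.val < α k ∧ ∀ i, τ i ≠ Sum.inl s := by
  simp only [mem_twoSidedMaps, Fin.snoc_injective_iff,
    Fin.forall_fin_succ', Fin.exists_fin_succ', Fin.snoc_castSucc, Fin.snoc_last, Set.mem_range,
    Fin.val_castSucc, Fin.val_last, TwoSidedAllowed, Sum.elim_inl, reduceCtorEq, or_false,
    not_exists]
  grind

theorem card_filter_val_lt {n a : ℕ} (h : a ≤ n) :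
    (Finset.univ.filter fun s : Fin n => s.val < a).card = a := by
  rw [Fin.card_filter_val_lt, min_eq_right h]

theorem card_unused_left {n : ℕ} {α β : ℕ → ℕ} (hα : Monotone α) {k : ℕ} (hk : α k ≤ n)
    {B : Finset (Fin n)} {τ : Fin k → Fin n ⊕ Fin n} (hτ : τ ∈ twoSidedMaps α β k B) :
    (Finset.univ.filter fun s : Fin n => s.val < α k ∧ ∀ i, τ i ≠ Sum.inl s).card =
      α k - (k - B.card) := by
  classical
  rw [mem_twoSidedMaps] at hτ
  obtain ⟨hinj, hall, hB⟩ := hτ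
  set u := Finset.univ.image τ with hu
  have hcard : u.card = k := by
    rw [hu, Finset.card_image_of_injective _ hinj, Finset.card_univ, Fintype.card_fin]
  have hright : u.toRight = B := by
    ext s
    simp [hu, hB]
  have hsum := u.card_toLeft_add_card_toRight
  rw [hright, hcard] at hsum
  have hsub : u.toLeft ⊆ Finset.univ.filter fun s : Fin n => s.val < α k := by
    intro s hs
    simp only [hu, Finset.mem_toLeft, Finset.mem_image, Finset.mem_univ, true_and] at hs
    obtain ⟨i, hi⟩ := hs
    have := hall i
    rw [hi] at this
    simp only [Finset.mem_filter, Finset.mem_univ, true_and]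
    exact lt_of_lt_of_le this (hα i.isLt.le)
  have heq : (Finset.univ.filter fun s : Fin n => s.val < α k ∧ ∀ i, τ i ≠ Sum.inl s) =
      (Finset.univ.filter fun s : Fin n => s.val < α k) \ u.toLeft := by
    ext s
    simp [hu]
  rw [heq, Finset.card_sdiff_of_subset hsub, card_filter_val_lt hk]
  omega

/-- Split on the last value. Under `hB`, all right values below `β k` lie in `B`, so exactly `|B| -
β k` choices remain on the right. On the left, the `k - |B|` values already used all lie below `α k`
by monotonicity. Hence the count depends on `B` only through its size. -/
theorem card_twoSidedMaps {n : ℕ} {α β : ℕ → ℕ} (hα : Monotone α) (hβ : Monotone β) (k : ℕ)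
    (hk : ∀ i < k, α i ≤ n ∧ β i ≤ n) (B : Finset (Fin n))
    (hB : ∀ i < k, ∀ s : Fin n, s.val < β i → s ∈ B) :
    (twoSidedMaps α β k B).card = twoSidedCount α β k B.card := by
  classical
  induction k generalizing B with
  | zero =>
    rw [twoSidedCount]
    split_ifs with h
    · rw [Finset.card_eq_zero.1 h]
      rw [twoSidedMaps, Finset.filter_true_of_mem]
      · simp
      · intro τ _
        exact ⟨fun i => i.elim0, fun i => i.elim0, fun s => by simp⟩
    · rw [Finset.card_eq_zero, twoSidedMaps, Finset.filter_eq_empty_iff]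
      rintro τ - ⟨-, -, h3⟩
      obtain ⟨s, hs⟩ := Finset.card_ne_zero.1 h
      obtain ⟨i, -⟩ := (h3 s).1 hs
      exact i.elim0
  | succ k ih =>
    have hk' : ∀ i < k, α i ≤ n ∧ β i ≤ n := fun i hi => hk i (by omega)
    have hfilter : (twoSidedMaps α β (k + 1) B).card = ∑ x : Fin n ⊕ Fin n,
        (Finset.univ.filter fun τ : Fin k → Fin n ⊕ Fin n =>
          Fin.snoc (α := fun _ => Fin n ⊕ Fin n) τ x ∈ twoSidedMaps α β (k + 1) B).card := by
      rw [← card_filter_pi_snoc fun τ => τ ∈ twoSidedMaps α β (k + 1) B, Finset.filter_univ_mem]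
    rw [hfilter, Fintype.sum_sum_type, add_comm, twoSidedCount]
    simp only [snoc_inl_mem_twoSidedMaps, snoc_inr_mem_twoSidedMaps]
    congr 1
    · have h1 : ∀ s : Fin n, (Finset.univ.filter fun τ : Fin k → Fin n ⊕ Fin n =>
          (s ∈ B ∧ β k ≤ s.val) ∧ τ ∈ twoSidedMaps α β k (B.erase s)).card =
          if s ∈ B ∧ β k ≤ s.val then twoSidedCount α β k (B.card - 1) else 0 := by
        intro s
        split_ifs with h
        · simp only [h, true_and, and_self, Finset.filter_univ_mem]
          rw [ih hk', Finset.card_erase_of_mem h.1]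
          -- The condition on `B` survives erasing `s`, since `s ≥ β k ≥ β i`.
          intro i hi t ht
          refine Finset.mem_erase.2 ⟨?_, hB i (by omega) t ht⟩
          rintro rfl
          have := hβ hi.le
          omega
        · simp [h]
      rw [Finset.sum_congr rfl fun s _ => h1 s, ← Finset.sum_filter, Finset.sum_const, smul_eq_mul]
      congr 1
      have h2 : (Finset.univ.filter fun s : Fin n => s ∈ B ∧ β k ≤ s.val) =
          B \ Finset.univ.filter fun s : Fin n => s.val < β k := by
        ext s
        simp
      rw [h2, Finset.card_sdiff_of_subset, card_filter_val_lt (hk k (by omega)).2]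
      intro s hs
      exact hB k (by omega) s (by simpa using hs)
    · rw [← ih hk' B fun i hi => hB i (by omega)]
      have h1 : ∀ s : Fin n, (Finset.univ.filter fun τ : Fin k → Fin n ⊕ Fin n =>
          τ ∈ twoSidedMaps α β k B ∧ s.val < α k ∧ ∀ i, τ i ≠ Sum.inl s).card =
          ∑ τ ∈ twoSidedMaps α β k B, if s.val < α k ∧ ∀ i, τ i ≠ Sum.inl s then 1 else 0 := by
        intro s
        rw [← Finset.card_filter]
        congr 1
        ext τ
        simp
      rw [Finset.sum_congr rfl fun s _ => h1 s, Finset.sum_comm]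
      simp only [← Finset.card_filter]
      rw [Finset.sum_congr rfl fun τ hτ => card_unused_left hα (hk k (by omega)).1 hτ,
        Finset.sum_const, smul_eq_mul, mul_comm]

open Classical in
theorem card_twoSided_perms {n : ℕ} {α β : ℕ → ℕ} (hα : Monotone α) (hβ : Monotone β)
    (hn : ∀ i < 2 * n, α i ≤ n ∧ β i ≤ n) (e : Fin (2 * n) ≃ Fin n ⊕ Fin n) :
    (Finset.univ.filter fun σ : Equiv.Perm (Fin (2 * n)) =>
      ∀ i : Fin (2 * n), TwoSidedAllowed α β i (e (σ i))).card = twoSidedCount α β (2 * n) n := by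
  have h := card_twoSidedMaps hα hβ (2 * n) hn Finset.univ fun _ _ _ _ => Finset.mem_univ _
  rw [Finset.card_univ, Fintype.card_fin] at h
  rw [← h]
  refine Finset.card_bij (fun σ _ => e ∘ σ) ?_ ?_ ?_
  · intro σ hσ
    simp only [Finset.mem_filter, Finset.mem_univ, true_and] at hσ
    rw [mem_twoSidedMaps]
    refine ⟨e.injective.comp σ.injective, hσ, fun s => ?_⟩
    simpa using (e.surjective.comp σ.surjective) (Sum.inr s)
  · intro σ _ σ' _ h
    refine Equiv.ext fun i => ?_
    simpa using congrFun h i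
  · intro τ hτ
    rw [mem_twoSidedMaps] at hτ
    have hinj : Function.Injective (e.symm ∘ τ) := e.symm.injective.comp hτ.1
    refine ⟨Equiv.ofBijective _ (Finite.injective_iff_bijective.1 hinj), ?_, ?_⟩
    · simpa using hτ.2.1
    · ext i
      simp

theorem twoSidedCount_eq_zero (α β : ℕ → ℕ) {k b : ℕ} (h : k < b) : twoSidedCount α β k b = 0 := by
  induction k generalizing b with
  | zero => simp [twoSidedCount, h.ne']
  | succ k ih => rw [twoSidedCount, ih (by omega), ih (by omega)]; simp

/-- The left coefficient of the recursion without truncated subtraction. -/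
theorem sub_sub_mul_twoSidedCount (α β : ℕ → ℕ) {a k b c : ℕ} (h : b ≤ k → c + k = a + b) :
    (a - (k - b)) * twoSidedCount α β k b = c * twoSidedCount α β k b := by
  rcases le_or_gt b k with hb | hb
  · have := h hb
    congr 1
    omega
  · simp [twoSidedCount_eq_zero α β hb]

/-- The height `d` is the excess of right values over half of the filled positions. Two positions
make one path step, the odd stage `h1` being the half-step that factors its weight. -/
theorem twoSidedCount_luschny (t d : ℕ) :
    twoSidedCount (fun k => (k + 1) / 2) (fun k => (k + 1) / 2) (2 * t) (t + d) =
      pathCount t d := by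
  induction t generalizing d with
  | zero => simp [twoSidedCount, pathCount]
  | succ t ih =>
    have h1 : ∀ e, twoSidedCount (fun k => (k + 1) / 2) (fun k => (k + 1) / 2) (2 * t + 1)
        (t + 1 + e) = (e + 1) * (pathCount t e + pathCount t (e + 1)) := by
      intro e
      rw [twoSidedCount, sub_sub_mul_twoSidedCount _ _ (c := e + 1) (by intros; omega),
        show t + 1 + e - 1 = t + e by omega, show t + 1 + e = t + (e + 1) by omega, ih, ih,
        show t + (e + 1) - (2 * t + 1) / 2 = e + 1 by omega]
      ring
    rw [show 2 * (t + 1) = 2 * t + 1 + 1 by ring, twoSidedCount,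
      sub_sub_mul_twoSidedCount _ _ (c := d + 1) (by intros; omega), h1,
      show t + 1 + d - (2 * t + 1 + 1) / 2 = d by omega, pathCount]
    rcases d with _ | d
    · ring
    · rw [show t + 1 + (d + 1) - 1 = t + 1 + d by omega, h1, Nat.add_sub_cancel]
      ring

/-- The same process displaced by half a step: here the path numbers appear at odd stages, and even
stages carry the intermediate values. -/
theorem twoSidedCount_band (t d : ℕ) :
    twoSidedCount (fun k => k / 2 + 1) (fun k => k / 2) (2 * t) (t + d) =
      (d + 1) * (pathCount t d + pathCount t (d + 1)) := by
  induction t generalizing d with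
  | zero => rcases d with _ | d <;> simp [twoSidedCount, pathCount]
  | succ t ih =>
    have h1 : ∀ e, twoSidedCount (fun k => k / 2 + 1) (fun k => k / 2) (2 * t + 1) (t + e) =
        pathCount (t + 1) e := by
      intro e
      rw [twoSidedCount, sub_sub_mul_twoSidedCount _ _ (c := e + 1) (by intros; omega), ih,
        show t + e - 2 * t / 2 = e by omega, pathCount]
      rcases e with _ | e
      · ring
      · rw [show t + (e + 1) - 1 = t + e by omega, ih, Nat.add_sub_cancel]
        ring
    rw [show 2 * (t + 1) = 2 * t + 1 + 1 by ring, twoSidedCount,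
      sub_sub_mul_twoSidedCount _ _ (c := d + 1) (by intros; omega),
      show t + 1 + d - 1 = t + d by omega, show t + 1 + d = t + (d + 1) by omega, h1, h1,
      show t + (d + 1) - (2 * t + 1) / 2 = d + 1 by omega]
    ring

/-! ### The two permanents as two-sided counts. -/

theorem luschnyMatrix_apply {n : ℕ} (j k : Fin (2 * n)) :
    luschnyMatrix n j k = (if j.val < n then -1 else 1) *
      if (j.val < n → j.val < (k.val + 1) / 2) ∧ (n ≤ j.val → (k.val + 1) / 2 ≤ j.val - n)
      then 1 else 0 := by
  have h : (2 * ((j.val : ℚ) + 1) - ((k.val : ℚ) + 1) - 1) / (2 * (n : ℚ)) =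
      ((2 * j.val - k.val : ℤ) : ℚ) / ((2 * n : ℕ) : ℚ) := by
    push_cast
    congr 1
    ring
  rw [luschnyMatrix, Matrix.of_apply, h, Rat.floor_intCast_div_natCast]
  have hj := j.isLt
  have hk := k.isLt
  have h0 : (0 : ℤ) < (2 * n : ℕ) := by omega
  -- With indices from 0 the numerator is `2j - k`. Rows `j < n` give only the values -1 (when `2j <
  -- k`) and 0; the others give 1 (when `2j - k ≥ 2n`) and 0.
  by_cases hjn : j.val < n
  · rcases lt_or_ge j.val ((k.val + 1) / 2) with h1 | h1
    · rw [if_pos hjn, if_pos ⟨fun _ => h1, by omega⟩, mul_one]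
      exact Int.ediv_eq_iff_of_pos h0 |>.2 (by push_cast; omega)
    · rw [if_neg (show ¬ ((j.val < n → j.val < (k.val + 1) / 2) ∧
        (n ≤ j.val → (k.val + 1) / 2 ≤ j.val - n)) by omega), mul_zero]
      exact Int.ediv_eq_iff_of_pos h0 |>.2 (by push_cast; omega)
  · rcases le_or_gt ((k.val + 1) / 2) (j.val - n) with h1 | h1
    · rw [if_neg hjn, if_pos ⟨by omega, fun _ => h1⟩, mul_one]
      exact Int.ediv_eq_iff_of_pos h0 |>.2 (by push_cast; omega)
    · rw [if_neg (show ¬ ((j.val < n → j.val < (k.val + 1) / 2) ∧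
        (n ≤ j.val → (k.val + 1) / 2 ≤ j.val - n)) by omega), mul_zero]
      exact Int.ediv_eq_iff_of_pos h0 |>.2 (by push_cast; omega)

/-- The indices below `n` on the left, the others on the right. -/
def halvesEquiv (n : ℕ) : Fin (2 * n) ≃ Fin n ⊕ Fin n :=
  (finCongr (two_mul n)).trans finSumFinEquiv.symm

theorem halvesEquiv_of_lt {n : ℕ} {j : Fin (2 * n)} (h : j.val < n) :
    halvesEquiv n j = Sum.inl ⟨j.val, h⟩ := by
  rw [halvesEquiv, Equiv.trans_apply, Equiv.symm_apply_eq]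
  ext
  simp

theorem halvesEquiv_of_le {n : ℕ} {j : Fin (2 * n)} (h : n ≤ j.val) :
    halvesEquiv n j = Sum.inr ⟨j.val - n, by omega⟩ := by
  rw [halvesEquiv, Equiv.trans_apply, Equiv.symm_apply_eq]
  ext
  simp
  omega

theorem prod_ite_one_zero {ι : Type*} [Fintype ι] {p : ι → Prop} [DecidablePred p] {q : Prop}
    [Decidable q] (h : (∀ i, p i) ↔ q) :
    ∏ i, (if p i then 1 else 0 : ℤ) = if q then 1 else 0 := by
  rw [Finset.prod_boole]
  exact if_congr (by simpa using h) rfl rfl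

/-- A permutation meets each of the `n` nonpositive rows exactly once, so all nonzero terms share
the sign `(-1) ^ n`. -/
theorem permanent_luschnyMatrix (n : ℕ) :
    (luschnyMatrix n).permanent = (-1) ^ n * (pathCount n 0 : ℤ) := by
  classical
  have hsign : ∀ σ : Equiv.Perm (Fin (2 * n)),
      ∏ i, (if (σ i).val < n then -1 else 1 : ℤ) = (-1) ^ n := by
    intro σ
    rw [Equiv.prod_comp σ fun j : Fin (2 * n) => (if j.val < n then -1 else 1 : ℤ),
      Finset.prod_ite, Finset.prod_const, Finset.prod_const_one, mul_one,
      card_filter_val_lt (by omega)]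
  rw [← twoSidedCount_luschny, add_zero, ← card_twoSided_perms (fun a b h => by omega)
    (fun a b h => by omega) (fun i hi => by omega) (halvesEquiv n),
    Finset.card_filter, Matrix.permanent, Nat.cast_sum, Finset.mul_sum]
  refine Finset.sum_congr rfl fun σ _ => ?_
  simp only [luschnyMatrix_apply]
  rw [Finset.prod_mul_distrib, hsign, Nat.cast_ite, Nat.cast_one, Nat.cast_zero]
  congr 1
  refine prod_ite_one_zero ?_
  refine forall_congr' fun i => ?_
  rcases lt_or_ge (σ i).val n with h | h
  · rw [halvesEquiv_of_lt h]
    simp only [TwoSidedAllowed, Sum.elim_inl]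
    omega
  · rw [halvesEquiv_of_le h]
    simp only [TwoSidedAllowed, Sum.elim_inr]
    omega

/-- The permutations satisfying the band condition. -/
def allBandPerms (n : ℕ) : Finset (Equiv.Perm (Fin (2 * n))) :=
  Finset.univ.filter fun π => ∀ i, InBand n i (π i)

theorem permanent_bandMatrix_eq_card (n : ℕ) :
    (bandMatrix n).permanent = ((allBandPerms n).card : ℤ) := by
  rw [← Matrix.permanent_transpose, Matrix.permanent, allBandPerms, Finset.card_filter]
  push_cast
  refine Finset.sum_congr rfl fun σ _ => ?_
  simp only [Matrix.transpose_apply, bandMatrix, Matrix.of_apply, Finset.prod_boole,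
    Finset.mem_univ, true_imp_iff]

theorem card_allBandPerms (n : ℕ) : (allBandPerms n).card = pathCount (n + 1) 0 := by
  classical
  have h := twoSidedCount_band n 0
  -- The halves are exchanged: in the band the small values are bounded below and the large ones
  -- above.
  rw [add_zero, ← card_twoSided_perms (fun a b h => by omega)
    (fun a b h => by omega) (fun i hi => by omega)
    ((halvesEquiv n).trans (Equiv.sumComm _ _))] at h
  rw [pathCount, allBandPerms]
  trans (0 + 1) * (pathCount n 0 + pathCount n (0 + 1))
  · rw [← h]
    congr 1
    ext σ
    rw [Finset.mem_filter, Finset.mem_filter]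
    simp only [Finset.mem_univ, true_and, Equiv.trans_apply]
    refine forall_congr' fun i => ?_
    rcases lt_or_ge (σ i).val n with h | h
    · rw [halvesEquiv_of_lt h]
      simp only [TwoSidedAllowed, InBand, Equiv.sumComm_apply, Sum.swap_inl, Sum.elim_inr]
      omega
    · rw [halvesEquiv_of_le h]
      simp only [TwoSidedAllowed, InBand, Equiv.sumComm_apply, Sum.swap_inr, Sum.elim_inl]
      omega
  · ring

end TwoSided

/-! ### Descents and the factor `2 ^ n`. -/

section BandPerms

/-- The permutations satisfying the band condition with descents at the first `s` pairs of
positions. -/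
def descentBandPerms (n s : ℕ) : Finset (Equiv.Perm (Fin (2 * n))) :=
  (allBandPerms n).filter fun π =>
    ∀ t : Fin n, t.val < s → π ⟨2 * t.val + 1, by omega⟩ < π ⟨2 * t.val, by omega⟩

theorem coe_descentBandPerms (n : ℕ) : (descentBandPerms n n : Set _) = bandPerms n := by
  ext π
  simp only [descentBandPerms, allBandPerms, Finset.coe_filter, Finset.mem_filter,
    Finset.mem_univ, true_and, Set.mem_ofPred_eq, bandPerms]
  constructor
  · rintro ⟨h1, h2⟩
    exact ⟨fun t ht => h2 ⟨t, ht⟩ ht, h1⟩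
  · rintro ⟨h1, h2⟩
    exact ⟨h2, fun t _ => h1 t.val t.isLt⟩

/-- The band depends on a position only through its pair, and the swap leaves the earlier pairs
alone. -/
theorem mul_swap_mem_descentBandPerms {n s : ℕ} (hs : s < n) {π : Equiv.Perm (Fin (2 * n))}
    (hπ : π ∈ descentBandPerms n s) :
    π * Equiv.swap ⟨2 * s, by omega⟩ ⟨2 * s + 1, by omega⟩ ∈ descentBandPerms n s := by
  simp only [descentBandPerms, allBandPerms, Finset.mem_filter, Finset.mem_univ, true_and] at hπ ⊢
  obtain ⟨h1, h2⟩ := hπ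
  constructor
  · intro i
    have key : ∀ a : Fin (2 * n), a.val / 2 = i.val / 2 → InBand n i (π a) := by
      intro a ha
      have := h1 a
      rwa [InBand, ha] at this
    rw [Equiv.Perm.mul_apply]
    apply key
    rw [Equiv.swap_apply_def]
    split_ifs with h h'
    · rw [h]
      dsimp only
      omega
    · rw [h']
      dsimp only
      omega
    · rfl
  · intro t ht
    have := h2 t ht
    rw [Equiv.Perm.mul_apply, Equiv.Perm.mul_apply, Equiv.swap_apply_of_ne_of_ne,
      Equiv.swap_apply_of_ne_of_ne]
    · exact this
    all_goals
      rw [ne_eq, Fin.mk.injEq]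
      omega

theorem card_descentBandPerms_succ {n s : ℕ} (hs : s < n) :
    (descentBandPerms n s).card = 2 * (descentBandPerms n (s + 1)).card := by
  set a : Fin (2 * n) := ⟨2 * s, by omega⟩ with ha
  set b : Fin (2 * n) := ⟨2 * s + 1, by omega⟩ with hb
  have hab : a ≠ b := by simp [ha, hb]
  have h1 : descentBandPerms n (s + 1) = (descentBandPerms n s).filter fun π => π b < π a := by
    ext π
    simp only [descentBandPerms, Finset.mem_filter, and_assoc]
    refine and_congr_right fun _ => ?_
    constructor
    · intro h
      exact ⟨fun t ht => h t (by omega), h ⟨s, hs⟩ (by simp)⟩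
    · rintro ⟨h, h'⟩ t ht
      rcases Nat.lt_succ_iff_lt_or_eq.1 ht with h3 | h3
      · exact h t h3
      · subst h3
        exact h'
  have h2 : ((descentBandPerms n s).filter fun π => ¬ π b < π a).card =
      ((descentBandPerms n s).filter fun π => π b < π a).card := by
    refine Finset.card_bij' (fun π _ => π * Equiv.swap a b) (fun π _ => π * Equiv.swap a b)
      ?_ ?_ ?_ ?_
    · intro π hπ
      rw [Finset.mem_filter] at hπ ⊢
      refine ⟨mul_swap_mem_descentBandPerms hs hπ.1, ?_⟩
      have := π.injective.ne hab
      simp only [Equiv.Perm.mul_apply, Equiv.swap_apply_left, Equiv.swap_apply_right]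
      exact lt_of_le_of_ne (not_lt.1 hπ.2) this
    · intro π hπ
      rw [Finset.mem_filter] at hπ ⊢
      refine ⟨mul_swap_mem_descentBandPerms hs hπ.1, ?_⟩
      simp only [Equiv.Perm.mul_apply, Equiv.swap_apply_left, Equiv.swap_apply_right]
      exact not_lt.2 hπ.2.le
    · intro π _
      simp [mul_assoc]
    · intro π _
      simp [mul_assoc]
  rw [h1, ← Finset.card_filter_add_card_filter_not (s := descentBandPerms n s)
    (fun π => π b < π a), h2]
  ring

theorem two_pow_mul_ncard_bandPerms (n : ℕ) :
    2 ^ n * (bandPerms n).ncard = (allBandPerms n).card := by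
  have h : ∀ s ≤ n, 2 ^ s * (descentBandPerms n s).card = (allBandPerms n).card := by
    intro s
    induction s with
    | zero => simp [descentBandPerms]
    | succ s ih =>
      intro hs
      rw [← ih (by omega), card_descentBandPerms_succ (by omega : s < n)]
      ring
  rw [← h n le_rfl, ← coe_descentBandPerms, Set.ncard_coe_finset]

end BandPerms

/-! ### Dellac configurations and their reading words. -/

section Dellac

/-- The position `2 c + j` for `j ∈ {0, 1}`. -/
def pairPos {n : ℕ} (c : Fin n) (j : Fin 2) : Fin (2 * n) := ⟨2 * c.val + j.val, by omega⟩

/-- The dots in the cells `(c, π(2c))` and `(c, π(2c + 1))`. -/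
def permConfig {n : ℕ} (π : Equiv.Perm (Fin (2 * n))) : Finset (Fin n × Fin (2 * n)) :=
  Finset.univ.filter fun p => p.2 = π (pairPos p.1 0) ∨ p.2 = π (pairPos p.1 1)

theorem columnRows_permConfig {n : ℕ} (π : Equiv.Perm (Fin (2 * n))) (c : Fin n) :
    columnRows (permConfig π) c = {π (pairPos c 0), π (pairPos c 1)} := by
  ext r
  simp [columnRows, permConfig]

theorem pairPos_ne {n : ℕ} (c : Fin n) : pairPos c 0 ≠ pairPos c 1 := by
  simp [pairPos]

theorem card_eq_sum_columnRows {n : ℕ} (C : Finset (Fin n × Fin (2 * n))) :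
    C.card = ∑ c, (columnRows C c).card := by
  rw [Finset.card_eq_sum_card_fiberwise (f := Prod.fst) (t := Finset.univ) (by simp)]
  refine Finset.sum_congr rfl fun c _ => ?_
  refine Finset.card_nbij' Prod.snd (fun r => (c, r)) ?_ ?_ ?_ ?_
  · rintro ⟨a, r⟩ h
    simp [columnRows] at h ⊢
    rw [← h.2]
    exact h.1
  · intro r h
    simpa [columnRows] using h
  · rintro ⟨a, r⟩ h
    simp at h
    simp [h.2]
  · intro r _
    rfl

theorem eq_pairPos {n : ℕ} (i : Fin (2 * n)) :
    i = pairPos ⟨i.val / 2, by omega⟩ 0 ∨ i = pairPos ⟨i.val / 2, by omega⟩ 1 := by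
  simp only [pairPos, Fin.ext_iff, Fin.val_zero, Fin.val_one]
  omega

theorem pairPos_inj {n : ℕ} {c d : Fin n} {i j : Fin 2} (h : pairPos c i = pairPos d j) :
    c = d := by
  simp only [pairPos, Fin.ext_iff] at h ⊢
  omega

theorem permConfig_mem_dellacConfigs {n : ℕ} {π : Equiv.Perm (Fin (2 * n))}
    (hπ : π ∈ bandPerms n) : permConfig π ∈ dellacConfigs n := by
  have hcol : ∀ c, (columnRows (permConfig π) c).card = 2 := fun c => by
    rw [columnRows_permConfig, Finset.card_pair (π.injective.ne (pairPos_ne c))]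
  refine ⟨?_, ?_, ?_, hcol⟩
  · rw [card_eq_sum_columnRows, Finset.sum_congr rfl fun c _ => hcol c]
    simp [mul_comm]
  · rintro ⟨c, r⟩ h
    have h0 := hπ.2 (pairPos c 0)
    have h1 := hπ.2 (pairPos c 1)
    simp only [InBand, pairPos, Fin.val_zero, Fin.val_one] at h0 h1
    simp only [permConfig, Finset.mem_filter, Finset.mem_univ, true_and] at h
    rcases h with rfl | rfl
    · simp only [pairPos, Fin.val_zero] at h0 ⊢
      omega
    · simp only [pairPos, Fin.val_one] at h1 ⊢
      omega
  · intro r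
    have h := eq_pairPos (π.symm r)
    refine ⟨⟨(π.symm r).val / 2, by omega⟩, ?_, ?_⟩
    · simp only [permConfig, Finset.mem_filter, Finset.mem_univ, true_and]
      rcases h with h | h
      · left
        rw [← h, Equiv.apply_symm_apply]
      · right
        rw [← h, Equiv.apply_symm_apply]
    · intro c hc
      simp only [permConfig, Finset.mem_filter, Finset.mem_univ, true_and] at hc
      rcases hc with hc | hc <;> rw [← Equiv.symm_apply_eq] at hc <;>
        rcases h with h | h <;> exact pairPos_inj (hc.symm.trans h)

theorem readingWord_permConfig {n : ℕ} {π : Equiv.Perm (Fin (2 * n))} (hπ : π ∈ bandPerms n) :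
    readingWord (permConfig π) = oneLine π := by
  have hsort : ∀ c : Fin n, (columnRows (permConfig π) c).sort (fun a b => b ≤ a) =
      [π (pairPos c 0), π (pairPos c 1)] := by
    intro c
    have hlt : π (pairPos c 1) < π (pairPos c 0) := hπ.1 c.val c.isLt
    have h2 : columnRows (permConfig π) c = [π (pairPos c 0), π (pairPos c 1)].toFinset := by
      rw [columnRows_permConfig]
      simp
    rw [h2]
    refine (List.toFinset_sort _ ?_).2 ?_
    · simp [hlt.ne']
    · simp [hlt.le]
  rw [readingWord, oneLine, List.ofFn_mul', List.flatMap_def, ← List.ofFn_eq_map]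
  congr 1
  congr 1
  funext c
  rw [hsort]
  rfl

theorem exists_eq_permConfig {n : ℕ} {C : Finset (Fin n × Fin (2 * n))}
    (hC : C ∈ dellacConfigs n) : ∃ π ∈ bandPerms n, permConfig π = C := by
  obtain ⟨-, hband, hrow, hcol⟩ := hC
  have hex : ∀ c : Fin n, ∃ x y : Fin (2 * n), y < x ∧ columnRows C c = {x, y} := by
    intro c
    obtain ⟨x, y, hxy, h⟩ := Finset.card_eq_two.1 (hcol c)
    rcases lt_or_gt_of_ne hxy with h' | h'
    · exact ⟨y, x, h', by rw [h, Finset.pair_comm]⟩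
    · exact ⟨x, y, h', h⟩
  choose x y hxy hxyc using hex
  have hmem : ∀ c r, (c, r) ∈ C ↔ r = x c ∨ r = y c := by
    intro c r
    have : r ∈ columnRows C c ↔ (c, r) ∈ C := by simp [columnRows]
    rw [← this, hxyc]
    simp
  let f : Fin (2 * n) → Fin (2 * n) := fun i =>
    if i.val % 2 = 0 then x ⟨i.val / 2, by omega⟩ else y ⟨i.val / 2, by omega⟩
  have hf0 : ∀ c, f (pairPos c 0) = x c := by
    intro c
    simp [f, pairPos]
  have hf1 : ∀ c, f (pairPos c 1) = y c := by
    intro c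
    have : (2 * c.val + 1) / 2 = c.val := by omega
    simp [f, pairPos, this]
  have hfC : ∀ i : Fin (2 * n), (⟨i.val / 2, by omega⟩, f i) ∈ C := by
    intro i
    rw [hmem]
    by_cases h : i.val % 2 = 0 <;> simp [f, h]
  -- Equal values share a row, so uniqueness of its dot forces the same column; within a column `y <
  -- x` separates the two positions.
  have hinj : Function.Injective f := by
    intro i j hij
    have hi := hfC i
    rw [hij] at hi
    have h1 := (hrow (f j)).unique hi (hfC j)
    have h2 : i.val / 2 = j.val / 2 := by simpa using h1
    by_cases h3 : i.val % 2 = 0 <;> by_cases h4 : j.val % 2 = 0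
    · ext; omega
    · simp only [f, h3, h4, if_true, if_false, h2] at hij
      exact absurd hij (hxy _).ne'
    · simp only [f, h3, h4, if_true, if_false, h2] at hij
      exact absurd hij (hxy _).ne
    · ext; omega
  refine ⟨Equiv.ofBijective f (Finite.injective_iff_bijective.1 hinj), ⟨?_, ?_⟩, ?_⟩
  · intro t ht
    have h0 := hf0 ⟨t, ht⟩
    have h1 := hf1 ⟨t, ht⟩
    have h2 := hxy ⟨t, ht⟩
    rw [← h0, ← h1] at h2
    exact h2
  · intro i
    exact hband _ (hfC i)
  · ext ⟨c, r⟩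
    rw [hmem, ← hf0, ← hf1]
    simp [permConfig]

theorem bijOn_readingWord (n : ℕ) :
    Set.BijOn readingWord (dellacConfigs n) (oneLine '' bandPerms n) := by
  refine ⟨?_, ?_, ?_⟩
  · intro C hC
    obtain ⟨π, hπ, rfl⟩ := exists_eq_permConfig hC
    exact ⟨π, hπ, (readingWord_permConfig hπ).symm⟩
  · intro C hC C' hC' h
    obtain ⟨π, hπ, rfl⟩ := exists_eq_permConfig hC
    obtain ⟨π', hπ', rfl⟩ := exists_eq_permConfig hC'
    rw [readingWord_permConfig hπ, readingWord_permConfig hπ'] at h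
    rw [DFunLike.coe_injective (List.ofFn_injective h)]
  · rintro _ ⟨π, hπ, rfl⟩
    exact ⟨permConfig π, permConfig_mem_dellacConfigs hπ, readingWord_permConfig hπ⟩

theorem oneLine_injective {m : ℕ} :
    Function.Injective (oneLine : Equiv.Perm (Fin m) → List (Fin m)) :=
  fun _ _ h => DFunLike.coe_injective (List.ofFn_injective h)

theorem ncard_dellacConfigs (n : ℕ) : (dellacConfigs n).ncard = (bandPerms n).ncard := by
  rw [← Set.ncard_image_of_injective (bandPerms n) oneLine_injective,
    ← (bijOn_readingWord n).image_eq, (bijOn_readingWord n).injOn.ncard_image]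

end Dellac

theorem mainTheorem2 (n : ℕ) (hn : 1 ≤ n) :
    ((luschnyMatrix n).permanent : ℚ) = (-1) ^ n * medianGenocchi n ∧
    ((bandMatrix n).permanent : ℚ) = medianGenocchi (n + 1) ∧
    ((bandMatrix n).permanent : ℚ) = 2 ^ n * normalizedMedianGenocchi n ∧
    (bandMatrix n).permanent = 2 ^ n * ((bandPerms n).ncard : ℤ) ∧
    ((bandPerms n).ncard : ℚ) = normalizedMedianGenocchi n ∧
    ((dellacConfigs n).ncard : ℚ) = normalizedMedianGenocchi n ∧
    Set.BijOn readingWord (dellacConfigs n) (oneLine '' bandPerms n) := by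
  have h1 : ((luschnyMatrix n).permanent : ℚ) = (-1) ^ n * medianGenocchi n := by
    rw [permanent_luschnyMatrix, ← pathCount_eq_medianGenocchi hn]
    push_cast
    rfl
  have h2 : ((bandMatrix n).permanent : ℚ) = medianGenocchi (n + 1) := by
    rw [permanent_bandMatrix_eq_card, card_allBandPerms,
      ← pathCount_eq_medianGenocchi (by omega : 1 ≤ n + 1)]
    push_cast
    rfl
  have hpow : (2 : ℚ) ^ n ≠ 0 := by positivity
  have h3 : ((bandMatrix n).permanent : ℚ) = 2 ^ n * normalizedMedianGenocchi n := by
    rw [h2, normalizedMedianGenocchi, mul_div_cancel₀ _ hpow]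
  have h4 : (bandMatrix n).permanent = 2 ^ n * ((bandPerms n).ncard : ℤ) := by
    rw [permanent_bandMatrix_eq_card, ← two_pow_mul_ncard_bandPerms]
    push_cast
    rfl
  have h5 : ((bandPerms n).ncard : ℚ) = normalizedMedianGenocchi n := by
    rw [h4] at h3
    push_cast at h3
    exact mul_left_cancel₀ hpow h3
  refine ⟨h1, h2, h3, h4, h5, ?_, bijOn_readingWord n⟩
  rw [ncard_dellacConfigs, h5]
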